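/- Let $R$ be a finite commutative local principal ideal ring with maximal ideal $\mathfrak m = Rp$, residue field $F_q$ of odd characteristic with $q$ elements, and let $\ell\ge 1$ be the nilpotency degree of $\mathfrak m$ (that is, $p^{\ell}=0\neq p^{\ell-1}$). Let $A=R[X]/(X^2-p,\,X^{2\ell-1})$, let $\pi$ be the image of $X$ in $A$, so that $A=R\oplus R\pi$, and let $*$ be the involution of $A$ that fixes $R$ elementwise and sends $\pi$ to $-\pi$. Let $V$ be a nonzero free $A$-module of finite rank and let $h:V\times V\to A$ be a nondegenerate skew hermitian form: $h$ is $A$-linear in the second variable and $*$-linear in the first, $h(v,u)=-h(u,v)^*$ for all $u,v\in V$, and $h(u,V)=0$ implies $u=0$. Let $U=\{g\in \mathrm{GL}_A(V) : h(gu,gv)=h(u,v)\ \text{for all } u,v\in V\}$ be the unitary group of $h$. Write $O_U(V)$ for the number of $U$-orbits on $V$. Then: (1) $O_U(V)=2(q^{\ell-1}+q^{\ell-2}+\cdots+q+1)$. (2) Let $f:V\times V\to R$ be the alternating form determined by $h(u,v)=f(u,v)+k(u,v)\pi$ with $f(u,v),k(u,v)\in R$, and let $H=R\times V$ be the Heisenberg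 group, with product $(r,u)(s,v)=(r+s+f(u,v),u+v)$. Let $\lambda:R^+\to\mathbb C^\times$ be a linear character whose kernel contains no nonzero ideal of $R$, let $S:H\to \mathrm{GL}(X)$ be an irreducible finite dimensional complex representation such that $S(r,0)=\lambda(r)\cdot 1_X$ for all $r\in R$, and let $W:U\to\mathrm{GL}(X)$ be a Weil representation of type $\lambda$, that is, a representation satisfying $W(g)S(r,u)W(g)^{-1}=S(r,gu)$ for all $g\in U$, $r\in R$, $u\in V$. Then $$[X,X]_U=\dim_{\mathbb C}\mathrm{Hom}_{\mathbb C U}(X,X)=O_U(V).$$ -/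

import Mathlib

open Polynomial

namespace RamifiedUnitary

noncomputable section

/-- The ring `A = R[X] / (X ^ 2 - p, X ^ (2 * ℓ - 1))`. -/
abbrev Ext (R : Type*) [CommRing R] (p : R) (ℓ : ℕ) : Type _ :=
  R[X] ⧸ (Ideal.span {X ^ 2 - C p, X ^ (2 * ℓ - 1)} : Ideal R[X])

section Ring

variable {R : Type*} [CommRing R] (p : R) (ℓ : ℕ)

/-- The image `π` of `X` in `A`. -/
def unif : Ext R p ℓ := Ideal.Quotient.mk _ X

/-- The involution `*` of `A`: the `R`-algebra endomorphism induced by `X ↦ -X`. -/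
def conj : Ext R p ℓ →+* Ext R p ℓ :=
  Ideal.quotientMap _ (aeval (-X : R[X])).toRingHom (by
    rw [Ideal.span_le]
    rintro x (rfl | rfl)
    · refine Ideal.subset_span (Or.inl ?_)
      simp
    · simp only [AlgHom.toRingHom_eq_coe, SetLike.mem_coe, Ideal.mem_comap,
        RingHom.coe_coe, map_pow, aeval_X]
      rw [neg_pow]
      exact Ideal.mul_mem_left _ _ (Ideal.subset_span (Or.inr rfl)))

theorem conj_algebraMap (r : R) :
    conj p ℓ (algebraMap R (Ext R p ℓ) r) = algebraMap R (Ext R p ℓ) r := by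
  change conj p ℓ (Ideal.Quotient.mk _ (C r)) = Ideal.Quotient.mk _ (C r)
  simp [conj]

theorem conj_unif : conj p ℓ (unif p ℓ) = - unif p ℓ := by
  simp [conj, unif]

theorem unif_sq : unif p ℓ ^ 2 = algebraMap R (Ext R p ℓ) p := by
  change Ideal.Quotient.mk _ X ^ 2 = Ideal.Quotient.mk _ (C p)
  rw [← map_pow, Ideal.Quotient.eq]
  exact Ideal.subset_span (Or.inl rfl)

/-- On polynomials: `∑ aᵢ X ^ i ↦ ∑ a₂ⱼ p ^ j`. -/
def evenPart : R[X] →ₗ[R] R :=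
  Polynomial.lsum fun n => if Even n then (p ^ (n / 2)) • LinearMap.id else 0

theorem evenPart_monomial (n : ℕ) (a : R) :
    evenPart p (monomial n a) = if Even n then p ^ (n / 2) * a else 0 := by
  unfold evenPart
  rw [Polynomial.lsum_apply, Polynomial.sum_monomial_index _ _ (by simp)]
  split_ifs <;> simp

variable {p ℓ}

theorem evenPart_eq_zero (hp : p ^ ℓ = 0) (P : R[X])
    (hP : P ∈ (Ideal.span {X ^ 2 - C p, X ^ (2 * ℓ - 1)} : Ideal R[X])) : evenPart p P = 0 := by
  obtain ⟨a, b, hab⟩ := Ideal.mem_span_pair.1 hP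
  clear hP
  have h1 : evenPart p (a * (X ^ 2 - C p)) = 0 := by
    clear hab
    induction a using Polynomial.induction_on' with
    | add f g hf hg => rw [add_mul, map_add, hf, hg, add_zero]
    | monomial n c =>
      rw [mul_sub, monomial_mul_X_pow, monomial_mul_C, map_sub, evenPart_monomial,
        evenPart_monomial]
      have he : Even (n + 2) ↔ Even n := by simp [Nat.even_add]
      have hd : (n + 2) / 2 = n / 2 + 1 := by omega
      simp only [he, hd]
      split_ifs <;> ring
  have h2 : evenPart p (b * X ^ (2 * ℓ - 1)) = 0 := by
    clear hab
    induction b using Polynomial.induction_on' with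
    | add f g hf hg => rw [add_mul, map_add, hf, hg, add_zero]
    | monomial n c =>
      rw [monomial_mul_X_pow, evenPart_monomial]
      split_ifs with he
      · have hle : ℓ ≤ (n + (2 * ℓ - 1)) / 2 := by
          obtain ⟨k, hk⟩ := he
          omega
        rw [pow_eq_zero_of_le hle hp, zero_mul]
      · rfl
  rw [← hab, map_add, h1, h2, add_zero]

/-- The projection `A = R ⊕ Rπ → R`, which sends `a + b π` to `a`. -/
def realPart (hp : p ^ ℓ = 0) : Ext R p ℓ →+ R :=
  QuotientAddGroup.lift _ (evenPart p).toAddMonoidHom (fun P hP => evenPart_eq_zero hp P hP)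

theorem realPart_add (hp : p ^ ℓ = 0) (a b : R) :
    realPart hp (algebraMap R (Ext R p ℓ) a + algebraMap R (Ext R p ℓ) b * unif p ℓ) = a := by
  change evenPart p (C a + C b * X) = a
  rw [← monomial_zero_left, C_mul_X_eq_monomial, map_add, evenPart_monomial, evenPart_monomial]
  simp

/-- Every element of `A` has the form `a + b π`; together with `realPart_add`, this shows that
`realPart` is the projection onto the first summand of `A = R ⊕ Rπ`. -/
theorem exists_eq_add (x : Ext R p ℓ) : ∃ a b : R,
    x = algebraMap R (Ext R p ℓ) a + algebraMap R (Ext R p ℓ) b * unif p ℓ := by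
  obtain ⟨P, rfl⟩ := Ideal.Quotient.mk_surjective x
  induction P using Polynomial.induction_on with
  | C r => exact ⟨r, 0, by simp; rfl⟩
  | add f g hf hg =>
    obtain ⟨a, b, h⟩ := hf
    obtain ⟨c, d, k⟩ := hg
    exact ⟨a + c, b + d, by rw [map_add, h, k, map_add, map_add]; ring⟩
  | monomial n r ih =>
    obtain ⟨a, b, h⟩ := ih
    refine ⟨b * p, a, ?_⟩
    have e : (C r * X ^ (n + 1) : R[X]) = C r * X ^ n * X := by ring
    have hX : (Ideal.Quotient.mk _ X : Ext R p ℓ) = unif p ℓ := rfl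
    rw [e, map_mul, h, map_mul, ← unif_sq, hX]
    ring

end Ring

section Form

variable {R : Type*} [CommRing R] {p : R} {ℓ : ℕ}
  {V : Type*} [AddCommGroup V] [Module (Ext R p ℓ) V]

/-- `h` is skew hermitian: `h(v, u) = -h(u, v)*`. (That it is `*`-linear in the first and linear
in the second variable is in its type.) -/
def IsSkewHermitian (h : V →ₛₗ[conj p ℓ] V →ₗ[Ext R p ℓ] Ext R p ℓ) : Prop :=
  ∀ u v : V, h v u = - conj p ℓ (h u v)

/-- The unitary group `U(V, h)`. -/
def unitary (h : V →ₛₗ[conj p ℓ] V →ₗ[Ext R p ℓ] Ext R p ℓ) : Subgroup (V ≃ₗ[Ext R p ℓ] V) where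
  carrier := {g | ∀ u v : V, h (g u) (g v) = h u v}
  one_mem' := fun _ _ => rfl
  mul_mem' := by
    intro a b ha hb u v
    rw [LinearEquiv.mul_apply, LinearEquiv.mul_apply, ha, hb]
  inv_mem' := by
    intro a ha u v
    have := ha (a⁻¹ u) (a⁻¹ v)
    rw [← LinearEquiv.mul_apply, ← LinearEquiv.mul_apply, mul_inv_cancel] at this
    exact this.symm

/-- The form `f : V × V → R` associated to `h`, given by `h(u, v) = f(u, v) + k(u, v) π`. -/
def assocForm (hp : p ^ ℓ = 0) (h : V →ₛₗ[conj p ℓ] V →ₗ[Ext R p ℓ] Ext R p ℓ) : V →+ V →+ R :=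
  AddMonoidHom.mk' (fun u => (realPart hp).comp (h u).toAddMonoidHom) (by
    intro a b
    ext v
    simp)

theorem assocForm_apply (hp : p ^ ℓ = 0) (h : V →ₛₗ[conj p ℓ] V →ₗ[Ext R p ℓ] Ext R p ℓ)
    (u v : V) : assocForm hp h u v = realPart hp (h u v) := rfl

end Form

/-- The Heisenberg group `R × V`, with product `(r, u) (s, v) = (r + s + f(u, v), u + v)`. -/
@[ext]
structure Heisenberg {R V : Type*} [AddCommGroup R] [AddCommGroup V] (f : V →+ V →+ R) where
  fst : R
  snd : V

instance {R V : Type*} [AddCommGroup R] [AddCommGroup V] (f : V →+ V →+ R) :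
    Mul (Heisenberg f) := ⟨fun x y => ⟨x.fst + y.fst + f x.snd y.snd, x.snd + y.snd⟩⟩

instance {R V : Type*} [AddCommGroup R] [AddCommGroup V] (f : V →+ V →+ R) :
    One (Heisenberg f) := ⟨⟨0, 0⟩⟩

instance {R V : Type*} [AddCommGroup R] [AddCommGroup V] (f : V →+ V →+ R) :
    Inv (Heisenberg f) := ⟨fun x => ⟨- x.fst + f x.snd x.snd, - x.snd⟩⟩

instance {R V : Type*} [AddCommGroup R] [AddCommGroup V] (f : V →+ V →+ R) :
    Group (Heisenberg f) :=
  Group.ofLeftAxioms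
    (by
      rintro ⟨r, u⟩ ⟨s, v⟩ ⟨t, w⟩
      change Heisenberg.mk _ _ = Heisenberg.mk _ _
      simp only [HMul.hMul, Mul.mul, map_add, AddMonoidHom.add_apply]
      congr 1 <;> abel)
    (by
      rintro ⟨r, u⟩
      change Heisenberg.mk (0 + r + f 0 u) (0 + u) = _
      simp)
    (by
      rintro ⟨r, u⟩
      change Heisenberg.mk (- r + f u u + r + f (-u) u) (-u + u) = Heisenberg.mk 0 0
      simp)

section Weil

variable {R : Type*} [CommRing R] {p : R} {ℓ : ℕ}
  {V : Type*} [AddCommGroup V] [Module (Ext R p ℓ) V]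
  {M : Type*} [AddCommGroup M] [Module ℂ M]

/-- A Schrödinger representation of type `lam`: an irreducible representation of the Heisenberg
group on which the central subgroup `(R, 0)` acts through `lam`. -/
def IsSchrodinger (f : V →+ V →+ R) (lam : AddChar R ℂ)
    (S : Representation ℂ (Heisenberg f) M) : Prop :=
  S.IsIrreducible ∧ ∀ (r : R) (x : M), S ⟨r, 0⟩ x = lam r • x

/-- A Weil representation `W` of the unitary group, relative to the Schrödinger representation
`S`: `W(g) S(r, u) W(g)⁻¹ = S(r, g u)`. -/
def IsWeil (hp : p ^ ℓ = 0) (h : V →ₛₗ[conj p ℓ] V →ₗ[Ext R p ℓ] Ext R p ℓ)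
    (S : Representation ℂ (Heisenberg (assocForm hp h)) M)
    (W : Representation ℂ (unitary h) M) : Prop :=
  ∀ (g : unitary h) (r : R) (u : V), W g * S ⟨r, u⟩ * W g⁻¹ = S ⟨r, g • u⟩

end Weil

/-- `O_G(Y)`, the number of orbits of `G` on `Y`. -/
def numOrbits (G Y : Type*) [Group G] [MulAction G Y] : ℕ :=
  Nat.card (MulAction.orbitRel.Quotient G Y)

end

end RamifiedUnitary

/-! Orbits. A vector `v` is `π ^ i • u` with `u` outside `π V` and `i ≤ 2ℓ - 1`, the top index being
that of `0`. The orbit of `v` is determined by `i` and `π ^ i * h u u`: two primitive vectors of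
equal length are joined by reflection-like isometries (`exists_unitary_smul_eq`), and a length may
be corrected by any skew amount killed by `π ^ i` without moving `π ^ i • u`
(`exists_form_add_smul_eq`). Lengths range over all skew elements `R π`, so `numOrbits_unitary`
counts the union of the sets `R π ^ (i + 1)`; the indices `2j` and `2j + 1` give `q ^ (ℓ - 1 - j)`
each.

Commutant. Conjugation by `S(0, w)` scales `S(0, v)` by `lam (2 f(w, v))`. These characters of `V`
are distinct, so the operators `S(0, v)` are independent; by Burnside they span, hence form a basis
of `End X` (`exists_basis_of_isSchrodinger`). The Weil representation permutes this basis as `U`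
permutes `V`, so the commutant has one dimension per orbit. -/

namespace RamifiedUnitary

/-! ### Operators commuting with a group representation -/

section Commutant

open Representation

/-- Burnside: the operators of an irreducible representation span the endomorphism algebra. -/
theorem span_range_eq_top_of_isIrreducible {k G M : Type*} [Field k] [IsAlgClosed k] [Group G]
    [AddCommGroup M] [Module k M] [FiniteDimensional k M] (S : Representation k G M)
    (hS : S.IsIrreducible) : Submodule.span k (Set.range S) = ⊤ := by
  rw [eq_top_iff]
  rintro T -
  have hbij := IsSimpleModule.algebraMap_end_bijective_of_isAlgClosed
    (A := MonoidAlgebra k G) (V := S.asModule) k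
  let T' : S.asModule →ₗ[k] S.asModule := T
  -- By Schur the module endomorphisms are scalars, so every `k`-linear map is linear over them, and
  -- the density theorem applies to it.
  let F : Module.End (Module.End (MonoidAlgebra k G) S.asModule) S.asModule :=
    { toFun := T'
      map_add' := T'.map_add
      map_smul' := fun f x => by
        obtain ⟨c, rfl⟩ := hbij.2 f
        exact T'.map_smul c x }
  obtain ⟨s, hs⟩ : (⊤ : Submodule k S.asModule).FG :=
    Module.Finite.fg_top
  obtain ⟨r, hr⟩ := jacobson_density F s
  have hT : T = S.asAlgebraHom r := by
    have h2 : T' = S.asAlgebraHom r := by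
      refine LinearMap.ext_on (s := (s : Set S.asModule)) hs ?_
      intro m hm
      exact hr m hm
    exact h2
  rw [hT]
  clear hr hT
  induction r using MonoidAlgebra.induction_linear with
  | zero => simp
  | add f g hf hg =>
    rw [map_add]
    exact Submodule.add_mem _ hf hg
  | single g c =>
    rw [Representation.asAlgebraHom_single]
    exact Submodule.smul_mem _ _ (Submodule.subset_span ⟨g, rfl⟩)

/-- Conjugation by `W g` permutes the coordinates in the basis `b`, so an operator commutes with `W`
exactly when its coordinates are constant on orbits. -/
theorem finrank_intertwiningMap_of_basis {k G M Y : Type*} [Field k] [Group G]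
    [AddCommGroup M] [Module k M] [Finite Y] [MulAction G Y]
    (W : Representation k G M) (b : Module.Basis Y k (Module.End k M))
    (hb : ∀ g y, W g * b y * W g⁻¹ = b (g • y)) :
    Module.finrank k (W.IntertwiningMap W) = Nat.card (MulAction.orbitRel.Quotient G Y) := by
  classical
  have := Fintype.ofFinite Y
  have := Fintype.ofFinite (MulAction.orbitRel.Quotient G Y)
  have hinv : ∀ g, W g⁻¹ * W g = 1 := fun g => by rw [← map_mul, inv_mul_cancel, map_one]
  have hconj : ∀ g y, W g * b y = b (g • y) * W g := fun g y => by
    rw [← hb, mul_assoc, hinv, mul_one]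
  let φ : (MulAction.orbitRel.Quotient G Y → k) →ₗ[k] W.IntertwiningMap W :=
    { toFun := fun c =>
        { toLinearMap := ∑ y, c (Quotient.mk _ y) • b y
          isIntertwining' := fun g => by
            change (∑ y, c (Quotient.mk _ y) • b y) * W g = W g * ∑ y, c (Quotient.mk _ y) • b y
            rw [Finset.sum_mul, Finset.mul_sum, ← Equiv.sum_comp (MulAction.toPerm g)]
            refine Finset.sum_congr rfl fun y _ => ?_
            rw [MulAction.toPerm_apply, smul_mul_assoc, mul_smul_comm, hconj,
              show (Quotient.mk _ (g • y) : MulAction.orbitRel.Quotient G Y) = Quotient.mk _ y from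
                Quotient.sound ⟨g, rfl⟩] }
      map_add' := fun c d => by
        apply IntertwiningMap.toLinearMap_injective
        simp [add_smul, Finset.sum_add_distrib]
      map_smul' := fun a c => by
        apply IntertwiningMap.toLinearMap_injective
        simp [mul_smul, Finset.smul_sum] }
  have hφ : ∀ c, (φ c).toLinearMap = b.equivFun.symm fun y => c (Quotient.mk _ y) := fun c => by
    rw [Module.Basis.equivFun_symm_apply]; rfl
  have hbij : Function.Bijective φ := by
    constructor
    · intro c d hcd
      have := congrArg IntertwiningMap.toLinearMap hcd
      rw [hφ, hφ] at this
      have := b.equivFun.symm.injective this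
      funext z
      induction z using Quotient.inductionOn with
      | h y => exact congrFun this y
    · intro T
      have hcomm : ∀ g, W g * T.toLinearMap * W g⁻¹ = T.toLinearMap := fun g => by
        have : T.toLinearMap * W g⁻¹ = W g⁻¹ * T.toLinearMap := T.isIntertwining' g⁻¹
        rw [mul_assoc, this, ← mul_assoc, ← map_mul, mul_inv_cancel, map_one, one_mul]
      have hconst : ∀ (g : G) (y : Y),
          b.equivFun T.toLinearMap (g • y) = b.equivFun T.toLinearMap y := by
        intro g y
        have h1 : T.toLinearMap = ∑ y, b.equivFun T.toLinearMap (g⁻¹ • y) • b y := by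
          conv_lhs => rw [← hcomm g, ← b.sum_equivFun T.toLinearMap]
          rw [Finset.mul_sum, Finset.sum_mul, ← Equiv.sum_comp (MulAction.toPerm g)
            (fun y => b.equivFun T.toLinearMap (g⁻¹ • y) • b y)]
          refine Finset.sum_congr rfl fun y _ => ?_
          rw [MulAction.toPerm_apply, inv_smul_smul, mul_smul_comm, smul_mul_assoc, hb]
        have h2 := congrArg (fun T => b.equivFun T (g • y)) h1
        change _ = b.equivFun _ _ at h2
        rw [← b.equivFun_symm_apply, LinearEquiv.apply_symm_apply, inv_smul_smul] at h2
        exact h2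
      refine ⟨fun z => Quotient.liftOn z (fun y => b.equivFun T.toLinearMap y) ?_, ?_⟩
      · rintro _ y ⟨g, rfl⟩
        exact hconst g y
      · apply IntertwiningMap.toLinearMap_injective
        change (φ _).toLinearMap = T.toLinearMap
        rw [hφ]
        exact b.equivFun.symm_apply_apply T.toLinearMap
  rw [← (LinearEquiv.ofBijective φ hbij).finrank_eq, Module.finrank_fintype_fun_eq_card,
    Nat.card_eq_fintype_card]

end Commutant

/-! ### Schrödinger representations of the Heisenberg group -/

section Schrodinger

variable {R : Type*} [CommRing R] {V : Type*} [AddCommGroup V] {f : V →+ V →+ R}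

theorem Heisenberg.mk_mul_mk (r s : R) (u v : V) :
    (⟨r, u⟩ * ⟨s, v⟩ : Heisenberg f) = ⟨r + s + f u v, u + v⟩ := rfl

/-- The operators `S(0, v)` of a Schrödinger representation form a basis of the endomorphism
algebra, if `lam` separates the points of `V` through `f`. -/
theorem exists_basis_of_isSchrodinger {M : Type*} [AddCommGroup M] [Module ℂ M]
    [FiniteDimensional ℂ M] {lam : AddChar R ℂ} {S : Representation ℂ (Heisenberg f) M}
    (hS : IsSchrodinger f lam S) (halt : ∀ u v, f v u = - f u v)
    (hsep : ∀ v, v ≠ 0 → ∃ w, lam (2 * f w v) ≠ 1) :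
    ∃ b : Module.Basis V ℂ (Module.End ℂ M), ∀ v, b v = S ⟨0, v⟩ := by
  have hsplit : ∀ (r : R) (v : V), S ⟨r, v⟩ = lam r • S ⟨0, v⟩ := fun r v => by
    have h1 : (⟨r, v⟩ : Heisenberg f) = ⟨r, 0⟩ * ⟨0, v⟩ := by
      simp [Heisenberg.mk_mul_mk]
    ext x
    rw [h1, map_mul, Module.End.mul_apply, hS.2, LinearMap.smul_apply]
  have hcomm : ∀ w v : V, S ⟨0, w⟩ * S ⟨0, v⟩ = lam (2 * f w v) • (S ⟨0, v⟩ * S ⟨0, w⟩) :=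
    fun w v => by
    rw [← map_mul, ← map_mul, Heisenberg.mk_mul_mk, Heisenberg.mk_mul_mk, hsplit,
      hsplit (0 + 0 + f v w), smul_smul, ← AddChar.map_add_eq_mul, add_comm v w, halt w v]
    congr 2
    ring
  have hinv : ∀ w : V, S ⟨0, w⟩ * S (⟨0, w⟩⁻¹) = 1 := fun w => by
    rw [← map_mul, mul_inv_cancel, map_one]
  have hinv' : ∀ w : V, S (⟨0, w⟩⁻¹) * S ⟨0, w⟩ = 1 := fun w => by
    rw [← map_mul, inv_mul_cancel, map_one]
  have hne : ∀ v : V, S ⟨0, v⟩ ≠ 0 := fun v h0 => by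
    have := hinv v
    rw [h0, zero_mul] at this
    have hM : Subsingleton M := ⟨fun x y => by
      rw [← Module.End.one_apply (R := ℂ) x, ← Module.End.one_apply (R := ℂ) y, ← this]; simp⟩
    have := hS.1
    obtain ⟨a, b, hab⟩ := this.exists_pair_ne
    exact hab (by ext x; rw [Subsingleton.elim x 0]; simp)
  have hli : LinearIndependent ℂ fun v : V => S ⟨0, v⟩ := by
    -- `χ v w` is the eigenvalue of conjugation by `S(0, w)` on `S(0, v)`. Dedekind's independence
    -- of characters will apply to the distinct `χ v`.
    let χ : V → Multiplicative V →* ℂ := fun v =>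
      { toFun := fun w => lam (2 * f w.toAdd v)
        map_one' := by simp
        map_mul' := fun a c => by
          rw [← AddChar.map_add_eq_mul, toAdd_mul, map_add, AddMonoidHom.add_apply, mul_add] }
    have hχ : Function.Injective χ := fun v v' hvv => by
      by_contra hne
      obtain ⟨w, hw⟩ := hsep (v - v') (sub_ne_zero.2 hne)
      apply hw
      have h1 : lam (2 * f w v) = lam (2 * f w v') :=
        DFunLike.congr_fun hvv (Multiplicative.ofAdd w)
      rw [map_sub, mul_sub, AddChar.map_sub_eq_div, h1, div_self]
      exact (lam.val_isUnit _).ne_zero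
    have hχli := (linearIndependent_monoidHom (Multiplicative V) ℂ).comp χ hχ
    rw [linearIndependent_iff'] at hχli ⊢
    intro s c hc v hv
    by_contra hcv
    -- Conjugating the relation by all `S(0, w)` and applying a functional `φ` gives a relation
    -- between the characters `χ v`, with coefficients `c v * φ (S ⟨0, v⟩)`.
    refine hne v ((Module.forall_dual_apply_eq_zero_iff ℂ (S ⟨0, v⟩)).1 fun φ => ?_)
    refine (mul_eq_zero.1 (hχli s (fun v => c v * φ (S ⟨0, v⟩)) ?_ v hv)).resolve_left hcv
    funext w
    have h1 := congrArg (fun T => φ (S ⟨0, w.toAdd⟩ * T * S (⟨0, w.toAdd⟩⁻¹))) hc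
    simp only [mul_zero, zero_mul, map_zero] at h1
    rw [Pi.zero_apply, ← h1, Finset.mul_sum, Finset.sum_mul, map_sum, Finset.sum_apply]
    refine Finset.sum_congr rfl fun v _ => ?_
    rw [mul_smul_comm, hcomm, smul_mul_assoc, smul_mul_assoc, mul_assoc, hinv, mul_one, map_smul,
      map_smul, Pi.smul_apply, smul_eq_mul, smul_eq_mul, smul_eq_mul]
    change c v * φ (S ⟨0, v⟩) * lam (2 * f w.toAdd v) = _
    ring
  refine ⟨Module.Basis.mk hli ?_, fun v => Module.Basis.mk_apply _ _ _⟩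
  rw [← span_range_eq_top_of_isIrreducible S hS.1, Submodule.span_le]
  rintro _ ⟨⟨r, v⟩, rfl⟩
  rw [hsplit]
  exact Submodule.smul_mem _ _ (Submodule.subset_span ⟨v, rfl⟩)

end Schrodinger

/-- If `a` is nilpotent, then every vector is a power of `a` times a primitive vector. -/
theorem exists_eq_pow_smul {S M : Type*} [CommRing S] [AddCommGroup M] [Module S M] {a : S} {N : ℕ}
    (hN : a ^ N = 0) (hex : ∃ u : M, ∀ w, u ≠ a • w) (v : M) :
    ∃ k ≤ N, ∃ u : M, (∀ w, u ≠ a • w) ∧ v = a ^ k • u := by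
  classical
  let P : ℕ → Prop := fun k => ∃ u, v = a ^ k • u
  have h0 : P 0 := ⟨v, by simp⟩
  obtain ⟨u, hu⟩ : P (Nat.findGreatest P N) := Nat.findGreatest_spec (Nat.zero_le N) h0
  have hle := Nat.findGreatest_le (P := P) N
  -- At the bound `N` the vector is zero, and any primitive vector serves; below it, maximality of
  -- the exponent makes `u` primitive.
  rcases hle.eq_or_lt with he | hlt
  · obtain ⟨w, hw⟩ := hex
    refine ⟨N, le_rfl, w, hw, ?_⟩
    rw [hu, he, hN, zero_smul, zero_smul]
  · refine ⟨_, hle, u, fun w hw => ?_, hu⟩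
    refine Nat.findGreatest_is_greatest (P := P) (Nat.lt_succ_self _) hlt ⟨w, ?_⟩
    rw [hu, hw, smul_smul, ← pow_succ]

theorem card_eq_card_ker_mul_card_range {R M N : Type*} [CommRing R] [AddCommGroup M] [Module R M]
    [AddCommGroup N] [Module R N] (f : M →ₗ[R] N) :
    Nat.card M = Nat.card (LinearMap.ker f) * Nat.card (LinearMap.range f) := by
  rw [Submodule.card_eq_card_quotient_mul_card (LinearMap.ker f),
    Nat.card_congr f.quotKerEquivRange.toEquiv]

/-! ### The chain of ideals of `R` -/

section BaseRing

variable {R : Type*} [CommRing R] [IsLocalRing R] {p : R} {ℓ : ℕ}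

theorem dvd_or_isUnit (hm : IsLocalRing.maximalIdeal R = Ideal.span {p}) (r : R) :
    p ∣ r ∨ IsUnit r := by
  by_contra! hr
  refine hr.1 ?_
  rw [← Ideal.mem_span_singleton, ← hm]
  exact (IsLocalRing.mem_maximalIdeal r).2 hr.2

theorem isUnit_two (hchar : ringChar (IsLocalRing.ResidueField R) ≠ 2) : IsUnit (2 : R) := by
  rw [← IsLocalRing.residue_ne_zero_iff_isUnit, map_ofNat]
  exact Ring.two_ne_zero hchar

/-- Write `r = p ^ k * u` with `u` a unit: then `p ^ (k + 1) = 0`, which forces `k ≥ ℓ - 1`. -/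
theorem pow_pred_dvd_of_mul_eq_zero (hm : IsLocalRing.maximalIdeal R = Ideal.span {p})
    (hp : p ^ ℓ = 0) (hp' : p ^ (ℓ - 1) ≠ 0) {r : R} (hr : p * r = 0) : p ^ (ℓ - 1) ∣ r := by
  have h1 : ∃ u : R, ∀ w, u ≠ p • w := ⟨1, fun w hw => by
    have h2 : p ∈ IsLocalRing.maximalIdeal R := hm ▸ Ideal.mem_span_singleton_self p
    exact (IsLocalRing.mem_maximalIdeal p).1 h2 (IsUnit.of_mul_eq_one w hw.symm)⟩
  obtain ⟨k, -, u, hu, rfl⟩ := exists_eq_pow_smul hp h1 r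
  have huu : IsUnit u := (dvd_or_isUnit hm u).resolve_left fun ⟨w, hw⟩ => hu w hw
  rw [smul_eq_mul, ← mul_assoc, ← pow_succ', huu.mul_left_eq_zero] at hr
  have : ¬ k + 1 ≤ ℓ - 1 := fun hk => hp' (pow_eq_zero_of_le hk hr)
  exact (pow_dvd_pow p (by omega)).mul_right _

/-- Multiplication by `p ^ (ℓ - 1)` has the maximal ideal as kernel, so its image is a copy of the
residue field. -/
theorem card_span_pow_pred [Finite R] (hm : IsLocalRing.maximalIdeal R = Ideal.span {p})
    (hℓ : 1 ≤ ℓ) (hp : p ^ ℓ = 0) (hp' : p ^ (ℓ - 1) ≠ 0) :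
    Nat.card (Ideal.span {p ^ (ℓ - 1)}) = Nat.card (IsLocalRing.ResidueField R) := by
  have hker : LinearMap.ker (LinearMap.toSpanSingleton R R (p ^ (ℓ - 1))) =
      IsLocalRing.maximalIdeal R := by
    ext r
    rw [LinearMap.mem_ker, LinearMap.toSpanSingleton_apply, smul_eq_mul]
    constructor
    · intro hr
      rw [IsLocalRing.mem_maximalIdeal]
      exact fun hu => hp' (hu.mul_right_eq_zero.1 hr)
    · intro hr
      rw [hm, Ideal.mem_span_singleton] at hr
      obtain ⟨s, rfl⟩ := hr
      rw [mul_right_comm, ← pow_succ', Nat.sub_add_cancel hℓ, hp, zero_mul]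
  rw [Ideal.span, ← LinearMap.range_toSpanSingleton,
    ← Nat.card_congr (LinearMap.quotKerEquivRange _).toEquiv, hker]
  rfl

/-- Multiplication by `p` maps each ideal of the chain onto the next smaller one, with kernel `(p ^
(ℓ - 1))` of `q` elements. -/
theorem card_span_pow [Finite R] (hm : IsLocalRing.maximalIdeal R = Ideal.span {p})
    (hp : p ^ ℓ = 0) (hp' : p ^ (ℓ - 1) ≠ 0) :
    ∀ j ≤ ℓ, Nat.card (Ideal.span {p ^ (ℓ - j)}) = Nat.card (IsLocalRing.ResidueField R) ^ j := by
  intro j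
  induction j with
  | zero => intro _; simp [hp]
  | succ j ih =>
    intro hj
    have e : ℓ - j = ℓ - (j + 1) + 1 := by omega
    let g : Ideal.span {p ^ (ℓ - (j + 1))} →ₗ[R] R :=
      (LinearMap.mulLeft R p).comp (Submodule.subtype _)
    have hg : LinearMap.range g = Ideal.span {p ^ (ℓ - j)} := by
      ext r
      rw [Ideal.mem_span_singleton, e]
      constructor
      · rintro ⟨⟨x, hx⟩, rfl⟩
        rw [pow_succ']
        exact mul_dvd_mul_left p (Ideal.mem_span_singleton.1 hx)
      · rintro ⟨s, rfl⟩
        refine ⟨⟨p ^ (ℓ - (j + 1)) * s, Ideal.mem_span_singleton.2 (dvd_mul_right _ _)⟩, ?_⟩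
        change p * (p ^ (ℓ - (j + 1)) * s) = _
        ring
    have hker : (LinearMap.ker g).map (Submodule.subtype _) = Ideal.span {p ^ (ℓ - 1)} := by
      ext r
      rw [Ideal.mem_span_singleton]
      constructor
      · rintro ⟨x, hx, rfl⟩
        exact pow_pred_dvd_of_mul_eq_zero hm hp hp' hx
      · rintro ⟨s, rfl⟩
        refine ⟨⟨p ^ (ℓ - 1) * s, Ideal.mem_span_singleton.2 ?_⟩, ?_, rfl⟩
        · exact (pow_dvd_pow p (by omega)).mul_right _
        · change p * (p ^ (ℓ - 1) * s) = 0
          rw [← mul_assoc, ← pow_succ', Nat.sub_add_cancel (by omega), hp, zero_mul]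
    rw [card_eq_card_ker_mul_card_range g, hg, ih (by omega), pow_succ',
      ← card_span_pow_pred hm (by omega) hp hp', ← hker]
    congr 1
    exact Nat.card_congr
      (Submodule.equivMapOfInjective _ (Submodule.subtype_injective _) _).toEquiv

end BaseRing

/-! ### The ramified extension `A` and its skew elements -/

section ExtRing

variable {R : Type*} [CommRing R] {p : R} {ℓ : ℕ}

theorem unif_pow_eq_zero : unif p ℓ ^ (2 * ℓ - 1) = 0 := by
  unfold unif
  rw [← map_pow, Ideal.Quotient.eq_zero_iff_mem]
  exact Ideal.subset_span (Or.inr rfl)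

theorem unif_pow_even (j : ℕ) : unif p ℓ ^ (2 * j) = algebraMap R (Ext R p ℓ) (p ^ j) := by
  rw [pow_mul, unif_sq, map_pow]

theorem realPart_algebraMap (hp : p ^ ℓ = 0) (a : R) :
    realPart hp (algebraMap R (Ext R p ℓ) a) = a := by
  simpa using realPart_add hp a 0

theorem algebraMap_ext_injective (hp : p ^ ℓ = 0) :
    Function.Injective (algebraMap R (Ext R p ℓ)) :=
  Function.LeftInverse.injective (realPart_algebraMap hp)

theorem unif_pow_ne_zero (hp : p ^ ℓ = 0) (hp' : p ^ (ℓ - 1) ≠ 0) {i : ℕ} (hi : i < 2 * ℓ - 1) :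
    unif p ℓ ^ i ≠ 0 := by
  intro h0
  have h1 : unif p ℓ ^ (2 * (ℓ - 1)) = 0 := pow_eq_zero_of_le (by omega) h0
  rw [unif_pow_even] at h1
  exact hp' (algebraMap_ext_injective hp (h1.trans (map_zero _).symm))

instance [Finite R] : Finite (Ext R p ℓ) :=
  Finite.of_surjective (fun x : R × R =>
    algebraMap R (Ext R p ℓ) x.1 + algebraMap R (Ext R p ℓ) x.2 * unif p ℓ) fun x => by
      obtain ⟨a, b, rfl⟩ := exists_eq_add x
      exact ⟨(a, b), rfl⟩

theorem conj_conj (x : Ext R p ℓ) : conj p ℓ (conj p ℓ x) = x := by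
  obtain ⟨a, b, rfl⟩ := exists_eq_add x
  simp [conj_algebraMap, conj_unif]

theorem isNilpotent_unif : IsNilpotent (unif p ℓ) := ⟨_, unif_pow_eq_zero⟩

/-- In effect `A` is local with maximal ideal `π A`: `a + b π` is a unit plus a nilpotent if `a` is
a unit, and otherwise `p = π ^ 2` divides `a`. -/
theorem unif_dvd_or_isUnit [IsLocalRing R] (hm : IsLocalRing.maximalIdeal R = Ideal.span {p})
    (x : Ext R p ℓ) : unif p ℓ ∣ x ∨ IsUnit x := by
  obtain ⟨a, b, rfl⟩ := exists_eq_add x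
  rcases dvd_or_isUnit hm a with ⟨c, rfl⟩ | ha
  · left
    rw [map_mul, ← unif_sq]
    exact ⟨unif p ℓ * algebraMap R (Ext R p ℓ) c + algebraMap R (Ext R p ℓ) b, by ring⟩
  · right
    exact IsNilpotent.isUnit_add_left_of_commute ((Commute.all _ _).isNilpotent_mul_left
      isNilpotent_unif) (ha.map _) (Commute.all _ _)

theorem IsUnit.add_of_unif_dvd {x y : Ext R p ℓ} (hx : IsUnit x) (hy : unif p ℓ ∣ y) :
    IsUnit (x + y) := by
  obtain ⟨z, rfl⟩ := hy
  exact IsNilpotent.isUnit_add_left_of_commute ((Commute.all _ _).isNilpotent_mul_right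
      isNilpotent_unif) hx (Commute.all _ _)

theorem isUnit_two_ext (h2 : IsUnit (2 : R)) : IsUnit (2 : Ext R p ℓ) := by
  have := h2.map (algebraMap R (Ext R p ℓ))
  rwa [map_ofNat] at this

theorem exists_eq_of_conj_eq_neg (hp : p ^ ℓ = 0) (h2 : IsUnit (2 : R)) {t : Ext R p ℓ}
    (ht : conj p ℓ t = - t) : ∃ b : R, t = algebraMap R (Ext R p ℓ) b * unif p ℓ := by
  obtain ⟨a, b, rfl⟩ := exists_eq_add t
  refine ⟨b, ?_⟩
  have h1 : algebraMap R (Ext R p ℓ) (2 * a) = algebraMap R (Ext R p ℓ) 0 := by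
    simp only [map_add, map_mul, conj_algebraMap, conj_unif, map_ofNat, map_zero] at ht ⊢
    linear_combination ht
  have h3 := h2.mul_right_eq_zero.1 (algebraMap_ext_injective hp h1)
  rw [h3, map_zero, zero_add]

theorem conj_algebraMap_mul_unif (b : R) :
    conj p ℓ (algebraMap R (Ext R p ℓ) b * unif p ℓ) =
      - (algebraMap R (Ext R p ℓ) b * unif p ℓ) := by
  rw [map_mul, conj_algebraMap, conj_unif]
  ring

theorem unif_dvd_of_conj_eq_neg (hp : p ^ ℓ = 0) (h2 : IsUnit (2 : R)) {t : Ext R p ℓ}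
    (ht : conj p ℓ t = - t) : unif p ℓ ∣ t := by
  obtain ⟨b, rfl⟩ := exists_eq_of_conj_eq_neg hp h2 ht
  exact dvd_mul_left _ _

/-- A quadratic equation in the skew elements annihilated by `x`, solved by finiteness. -/
theorem exists_conj_eq_neg_two_mul_sub [Finite R] (hp : p ^ ℓ = 0) (h2 : IsUnit (2 : R))
    {x d e : Ext R p ℓ} (he : conj p ℓ e = - e) (hd : conj p ℓ d = - d) (hxd : x * d = 0) :
    ∃ t, conj p ℓ t = - t ∧ x * t = 0 ∧ 2 * t - t ^ 2 * e = d := by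
  let T : Type _ := {t : Ext R p ℓ // conj p ℓ t = - t ∧ x * t = 0}
  let F : T → T := fun t => ⟨2 * t.1 - t.1 ^ 2 * e, by
    rw [map_sub, map_mul, map_mul, map_pow, map_ofNat, t.2.1, he]
    ring, by
    linear_combination (2 - t.1 * e) * t.2.2⟩
  -- A difference of values factors as `(2 - (t + t') e) (t - t')`, whose first factor is a unit
  -- because the skew element `e` lies in `π A`.
  have hF : Function.Injective F := fun t t' htt => by
    have h1 : 2 * t.1 - t.1 ^ 2 * e = 2 * t'.1 - t'.1 ^ 2 * e := congrArg Subtype.val htt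
    have h3 : IsUnit (2 + -((t.1 + t'.1) * e)) :=
      IsUnit.add_of_unif_dvd (isUnit_two_ext h2)
        ((unif_dvd_of_conj_eq_neg hp h2 he).mul_left _).neg_right
    have h4 : (2 + -((t.1 + t'.1) * e)) * (t.1 - t'.1) = 0 := by linear_combination h1
    exact Subtype.ext (sub_eq_zero.1 (h3.mul_right_eq_zero.1 h4))
  obtain ⟨t, ht⟩ := Finite.surjective_of_injective hF ⟨d, hd, hxd⟩
  exact ⟨t.1, t.2.1, t.2.2, congrArg Subtype.val ht⟩

/-- The set of all `π ^ i s`, where `s` is skew. -/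
def skewMultiples (p : R) (ℓ i : ℕ) : Set (Ext R p ℓ) :=
  {y | ∃ s, conj p ℓ s = - s ∧ unif p ℓ ^ i * s = y}

theorem mem_skewMultiples_iff (hp : p ^ ℓ = 0) (h2 : IsUnit (2 : R)) (i : ℕ) (y : Ext R p ℓ) :
    y ∈ skewMultiples p ℓ i ↔ ∃ b : R, y = algebraMap R (Ext R p ℓ) b * unif p ℓ ^ (i + 1) := by
  constructor
  · rintro ⟨s, hs, rfl⟩
    obtain ⟨b, rfl⟩ := exists_eq_of_conj_eq_neg hp h2 hs
    exact ⟨b, by ring⟩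
  · rintro ⟨b, rfl⟩
    exact ⟨_, conj_algebraMap_mul_unif b, by ring⟩

variable [IsLocalRing R]

/-- The exponent of `π` is now even, so the set is the copy in `A` of the ideal `(p ^ (j + 1))` of
`R`. -/
theorem card_skewMultiples_odd [Finite R] (hm : IsLocalRing.maximalIdeal R = Ideal.span {p})
    (hp : p ^ ℓ = 0) (hp' : p ^ (ℓ - 1) ≠ 0) (h2 : IsUnit (2 : R)) {j : ℕ} (hj : j < ℓ) :
    Nat.card (skewMultiples p ℓ (2 * j + 1)) =
      Nat.card (IsLocalRing.ResidueField R) ^ (ℓ - 1 - j) := by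
  rw [← card_span_pow hm hp hp' _ (by omega), show ℓ - (ℓ - 1 - j) = j + 1 by omega]
  have : skewMultiples p ℓ (2 * j + 1) =
      algebraMap R (Ext R p ℓ) '' (Ideal.span {p ^ (j + 1)} : Ideal R) := by
    ext y
    rw [mem_skewMultiples_iff hp h2, show 2 * j + 1 + 1 = 2 * (j + 1) by ring, unif_pow_even]
    constructor
    · rintro ⟨b, rfl⟩
      exact ⟨b * p ^ (j + 1), Ideal.mem_span_singleton.2 (dvd_mul_left _ _), map_mul _ _ _⟩
    · rintro ⟨_, hx, rfl⟩
      obtain ⟨b, rfl⟩ := Ideal.mem_span_singleton.1 hx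
      exact ⟨b, by rw [map_mul, mul_comm]⟩
  rw [this, Nat.card_image_of_injective (algebraMap_ext_injective hp)]
  rfl

/-- Multiplication by `π` is injective on `R π ^ (2j + 1)`: if `p ^ (j + 1) * (b - c) = 0`, then `p
^ j * (b - c)` lies in `(p ^ (ℓ - 1))`, which is killed by `π` since `π ^ (2ℓ - 1) = 0`. -/
theorem card_skewMultiples_even (hm : IsLocalRing.maximalIdeal R = Ideal.span {p})
    (hp : p ^ ℓ = 0) (hp' : p ^ (ℓ - 1) ≠ 0) (h2 : IsUnit (2 : R)) (j : ℕ) :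
    Nat.card (skewMultiples p ℓ (2 * j)) = Nat.card (skewMultiples p ℓ (2 * j + 1)) := by
  have : skewMultiples p ℓ (2 * j + 1) = (unif p ℓ * ·) '' skewMultiples p ℓ (2 * j) := by
    ext y
    rw [mem_skewMultiples_iff hp h2]
    constructor
    · rintro ⟨b, rfl⟩
      exact ⟨_, (mem_skewMultiples_iff hp h2 _ _).2 ⟨b, rfl⟩, by ring⟩
    · rintro ⟨z, hz, rfl⟩
      obtain ⟨b, rfl⟩ := (mem_skewMultiples_iff hp h2 _ _).1 hz
      exact ⟨b, by ring⟩
  rw [this, Nat.card_image_of_injOn]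
  intro y hy z hz hyz
  obtain ⟨b, rfl⟩ := (mem_skewMultiples_iff hp h2 _ _).1 hy
  obtain ⟨c, rfl⟩ := (mem_skewMultiples_iff hp h2 _ _).1 hz
  have h1 : algebraMap R (Ext R p ℓ) (p * (p ^ j * (b - c))) = algebraMap R (Ext R p ℓ) 0 := by
    have h3 : unif p ℓ ^ (2 * (j + 1)) * algebraMap R (Ext R p ℓ) (b - c) = 0 := by
      rw [map_sub]
      linear_combination hyz
    rw [map_zero, ← h3, unif_pow_even, ← map_mul]
    congr 1
    ring
  obtain ⟨s, hs⟩ := pow_pred_dvd_of_mul_eq_zero hm hp hp' (algebraMap_ext_injective hp h1)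
  rw [← sub_eq_zero]
  have hℓ : ℓ ≠ 0 := fun h0 => by
    subst h0
    simp at hp hp'
  calc _ = algebraMap R (Ext R p ℓ) (p ^ j * (b - c)) * unif p ℓ := by
        rw [map_mul, ← unif_pow_even, map_sub]; ring
    _ = unif p ℓ ^ (2 * (ℓ - 1) + 1) * algebraMap R (Ext R p ℓ) s := by
        rw [hs, map_mul, ← unif_pow_even]; ring
    _ = 0 := by rw [show 2 * (ℓ - 1) + 1 = 2 * ℓ - 1 by omega, unif_pow_eq_zero, zero_mul]

theorem sum_card_skewMultiples [Finite R]
    (hm : IsLocalRing.maximalIdeal R = Ideal.span {p})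
    (hp : p ^ ℓ = 0) (hp' : p ^ (ℓ - 1) ≠ 0) (h2 : IsUnit (2 : R)) :
    ∑ i ∈ Finset.range (2 * ℓ), Nat.card (skewMultiples p ℓ i) =
      2 * ∑ i ∈ Finset.range ℓ, Nat.card (IsLocalRing.ResidueField R) ^ i := by
  have h1 : ∀ n ≤ ℓ, ∑ i ∈ Finset.range (2 * n), Nat.card (skewMultiples p ℓ i) =
      ∑ j ∈ Finset.range n, 2 * Nat.card (IsLocalRing.ResidueField R) ^ (ℓ - 1 - j) := by
    intro n
    induction n with
    | zero => simp
    | succ n ih =>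
      intro hn
      rw [show 2 * (n + 1) = 2 * n + 1 + 1 by ring, Finset.sum_range_succ, Finset.sum_range_succ,
        ih (by omega), Finset.sum_range_succ, card_skewMultiples_even hm hp hp' h2,
        card_skewMultiples_odd hm hp hp' h2 (by omega)]
      ring
  rw [h1 ℓ le_rfl, Finset.mul_sum,
    Finset.sum_range_reflect (fun j => 2 * Nat.card (IsLocalRing.ResidueField R) ^ j)]

end ExtRing

/-! ### Primitive vectors, isometries and orbits -/

section Hermitian

variable {R : Type*} [CommRing R] {p : R} {ℓ : ℕ}
  {V : Type*} [AddCommGroup V] [Module (Ext R p ℓ) V]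
  {h : V →ₛₗ[conj p ℓ] V →ₗ[Ext R p ℓ] Ext R p ℓ}

theorem form_smul_left (t : Ext R p ℓ) (u v : V) : h (t • u) v = conj p ℓ t * h u v := by
  rw [map_smulₛₗ, LinearMap.smul_apply, smul_eq_mul]

theorem form_smul_right (t : Ext R p ℓ) (u v : V) : h u (t • v) = t * h u v := by
  rw [map_smul, smul_eq_mul]

theorem IsSkewHermitian.conj_self (hskew : IsSkewHermitian h) (u : V) :
    conj p ℓ (h u u) = - h u u := by
  rw [eq_neg_iff_add_eq_zero, add_comm, ← eq_neg_iff_add_eq_zero]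
  exact hskew u u

theorem isUnit_form_comm (hskew : IsSkewHermitian h) {u v : V} (huv : IsUnit (h u v)) :
    IsUnit (h v u) := by
  rw [hskew u v]
  exact (huv.map (conj p ℓ)).neg

/-- The vectors of `V` outside `π V`. -/
def IsPrimitiveVector (p : R) (ℓ : ℕ) {V : Type*} [AddCommGroup V] [Module (Ext R p ℓ) V]
    (u : V) : Prop := ∀ w, u ≠ unif p ℓ • w

theorem smul_isPrimitiveVector (g : unitary h) {u : V} (hu : IsPrimitiveVector p ℓ u) :
    IsPrimitiveVector p ℓ (g • u) := by
  intro w hw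
  refine hu (g⁻¹ • w) ?_
  have : g⁻¹ • (unif p ℓ • w) = unif p ℓ • (g⁻¹ • w) := map_smul (g⁻¹).1 _ _
  rw [← this, ← hw, inv_smul_smul]

theorem IsPrimitiveVector.add_smul {u : V} (hu : IsPrimitiveVector p ℓ u) {t : Ext R p ℓ}
    (ht : unif p ℓ ∣ t) (w : V) : IsPrimitiveVector p ℓ (u + t • w) := by
  intro z hz
  obtain ⟨r, rfl⟩ := ht
  refine hu (z - r • w) ?_
  rw [smul_sub, ← hz, smul_smul, add_sub_cancel_right]

theorem exists_isPrimitiveVector [Nontrivial V] : ∃ u : V, IsPrimitiveVector p ℓ u := by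
  by_contra! hall
  have hdiv : ∀ (n : ℕ) (v : V), ∃ w, v = unif p ℓ ^ n • w := by
    intro n
    induction n with
    | zero => exact fun v => ⟨v, by simp⟩
    | succ n ih =>
      intro v
      obtain ⟨w, rfl⟩ := ih v
      have := hall w
      simp only [IsPrimitiveVector, ne_eq, not_forall, not_not] at this
      obtain ⟨z, rfl⟩ := this
      exact ⟨z, by rw [smul_smul, ← pow_succ]⟩
  obtain ⟨v, hv⟩ := exists_ne (0 : V)
  obtain ⟨w, hw⟩ := hdiv (2 * ℓ - 1) v
  rw [unif_pow_eq_zero] at hw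
  exact hv (hw.trans (zero_smul (Ext R p ℓ) w))

/-- Both sides equal `π ^ i * h u v`; the sign `(-1) ^ i` from the first variable cancels. So the
invariant of an orbit is well defined. -/
theorem unif_pow_mul_form_eq {u v : V} {i : ℕ} (huv : unif p ℓ ^ i • u = unif p ℓ ^ i • v) :
    unif p ℓ ^ i * h u u = unif p ℓ ^ i * h v v := by
  have h1 : (-1) ^ i * (unif p ℓ ^ i * h u v) = (-1) ^ i * (unif p ℓ ^ i * h v v) := by
    have h2 : (-1) ^ i * unif p ℓ ^ i = conj p ℓ (unif p ℓ ^ i) := by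
      rw [map_pow, conj_unif]
      exact (neg_pow (unif p ℓ) i).symm
    rw [← mul_assoc, ← mul_assoc, h2, ← form_smul_left, ← form_smul_left, huv]
  rw [← form_smul_right, huv, form_smul_right]
  exact (isUnit_one.neg.pow i).mul_left_cancel h1

/-- Changing a vector to one of prescribed length. -/
theorem exists_form_add_smul_eq [Finite R] (hp : p ^ ℓ = 0) (h2 : IsUnit (2 : R))
    (hskew : IsSkewHermitian h) {a b : V} (hab : h a b = 1) {x s : Ext R p ℓ}
    (hs : conj p ℓ s = - s) (hx : x * (s - h a a) = 0) :
    ∃ t, conj p ℓ t = - t ∧ x * t = 0 ∧ h (a + t • b) (a + t • b) = s := by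
  have hba : h b a = - 1 := by rw [hskew a b, hab, map_one]
  -- For skew `t`, the vector `a + t • b` has length `h a a + 2 t - t ^ 2 * h b b`.
  obtain ⟨t, ht, hxt, he⟩ := exists_conj_eq_neg_two_mul_sub hp h2 (hskew.conj_self b)
    (show conj p ℓ (s - h a a) = - (s - h a a) by rw [map_sub, hs, hskew.conj_self a]; ring) hx
  refine ⟨t, ht, hxt, ?_⟩
  simp only [map_add, LinearMap.add_apply, form_smul_left, form_smul_right, ht, hab, hba]
  linear_combination he

theorem exists_isPrimitiveVector_eq_pow_smul [Nontrivial V] (v : V) :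
    ∃ k ≤ 2 * ℓ - 1, ∃ u : V, IsPrimitiveVector p ℓ u ∧ v = unif p ℓ ^ k • u :=
  exists_eq_pow_smul unif_pow_eq_zero exists_isPrimitiveVector v

theorem assocForm_swap (hp : p ^ ℓ = 0) (hskew : IsSkewHermitian h) (u v : V) :
    assocForm hp h v u = - assocForm hp h u v := by
  rw [assocForm_apply, assocForm_apply, hskew u v, map_neg]
  obtain ⟨a, b, hab⟩ := exists_eq_add (h u v)
  have : conj p ℓ (h u v) =
      algebraMap R (Ext R p ℓ) a + algebraMap R (Ext R p ℓ) (-b) * unif p ℓ := by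
    rw [hab, map_add, map_mul, conj_algebraMap, conj_algebraMap, conj_unif, map_neg]
    ring
  rw [this, hab, realPart_add, realPart_add]

/-- A unitary transformation that maps `u` to `v`, in the direction of `v - u`. -/
theorem exists_unitary_of_isUnit_form [Finite R] [Module.Finite (Ext R p ℓ) V] (hp : p ^ ℓ = 0)
    (h2 : IsUnit (2 : R)) (hskew : IsSkewHermitian h) (hnondeg : h.SeparatingLeft) {u v : V}
    (huv : h u u = h v v) (hu : IsUnit (h v u)) : ∃ g : unitary h, g • u = v := by
  have : Finite V := Module.finite_of_finite (Ext R p ℓ)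
  obtain ⟨x, hx⟩ : ∃ x, x = v - u := ⟨_, rfl⟩
  have hc : IsUnit (h x u) := by
    have e : h x u = h v u + -h u u := by
      rw [hx, map_sub, LinearMap.sub_apply]
      ring
    rw [e]
    exact IsUnit.add_of_unif_dvd hu (unif_dvd_of_conj_eq_neg hp h2 (hskew.conj_self u)).neg_right
  obtain ⟨a, ha⟩ := hc.exists_left_inv
  -- Equality of the lengths of `u` and `v` enters here; multiplied by `a a*`, this is the condition
  -- for `w ↦ w + h(x, w) a x` to preserve `h`. The choice `a = h(x, u)⁻¹` makes it send `u` to `u +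
  -- x = v`.
  have hxx : conj p ℓ (h x u) - h x u = h x x := by
    rw [show conj p ℓ (h x u) = - h u x by rw [hskew x u, neg_neg], hx]
    simp only [map_sub, LinearMap.sub_apply]
    linear_combination huv
  have ha' : conj p ℓ a * conj p ℓ (h x u) = 1 := by rw [← map_mul, ha, map_one]
  have hcoef : a - conj p ℓ a = a * conj p ℓ a * h x x := by
    rw [← hxx]
    linear_combination conj p ℓ a * ha - a * ha'
  let f : V →ₗ[Ext R p ℓ] V := LinearMap.id + (h x).smulRight (a • x)
  have hf : ∀ w, f w = w + (h x w * a) • x := fun w => by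
    rw [mul_smul]; rfl
  have hfh : ∀ w z, h (f w) (f z) = h w z := fun w z => by
    have e : conj p ℓ (h x w) = - h w x := by rw [hskew x w, neg_neg]
    simp only [hf, map_add, LinearMap.add_apply, form_smul_left, form_smul_right, map_mul, e]
    linear_combination h w x * h x z * hcoef
  have hinj : Function.Injective f := by
    rw [injective_iff_map_eq_zero]
    intro w hw
    refine hnondeg w fun z => ?_
    rw [← hfh, hw, map_zero, LinearMap.zero_apply]
  refine ⟨⟨LinearEquiv.ofBijective f (Finite.injective_iff_bijective.1 hinj), hfh⟩, ?_⟩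
  change f u = v
  rw [hf, mul_comm (h x u), ha, one_smul, hx, add_sub_cancel]

variable [IsLocalRing R]

/-- In a basis, a primitive vector has a unit coordinate, since otherwise `π` would divide all of
them. -/
theorem IsPrimitiveVector.unif_pow_smul_ne_zero [Module.Free (Ext R p ℓ) V]
    [Module.Finite (Ext R p ℓ) V] (hm : IsLocalRing.maximalIdeal R = Ideal.span {p})
    (hp : p ^ ℓ = 0) (hp' : p ^ (ℓ - 1) ≠ 0) {u : V} (hu : IsPrimitiveVector p ℓ u) {i : ℕ}
    (hi : i < 2 * ℓ - 1) : unif p ℓ ^ i • u ≠ 0 := by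
  intro h0
  have : Nontrivial (Ext R p ℓ) := ⟨_, _, unif_pow_ne_zero hp hp' hi⟩
  let b := Module.Free.chooseBasis (Ext R p ℓ) V
  by_cases hc : ∃ k, IsUnit (b.equivFun u k)
  · obtain ⟨k, hk⟩ := hc
    have h1 : b.equivFun (unif p ℓ ^ i • u) k = 0 := by rw [h0, map_zero, Pi.zero_apply]
    rw [map_smul, Pi.smul_apply, smul_eq_mul, hk.mul_left_eq_zero] at h1
    exact unif_pow_ne_zero hp hp' hi h1
  · push Not at hc
    choose c hc' using fun k => (unif_dvd_or_isUnit hm (b.equivFun u k)).resolve_right (hc k)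
    refine hu (b.equivFun.symm c) ?_
    rw [← map_smul, LinearEquiv.eq_symm_apply]
    funext k
    exact hc' k

/-- If `h u w` were always in `π A`, then `π ^ (2ℓ - 2) • u`, which is nonzero, would lie in the
radical. -/
theorem IsPrimitiveVector.exists_form_eq_one [Module.Free (Ext R p ℓ) V]
    [Module.Finite (Ext R p ℓ) V] (hm : IsLocalRing.maximalIdeal R = Ideal.span {p})
    (hℓ : 1 ≤ ℓ) (hp : p ^ ℓ = 0) (hp' : p ^ (ℓ - 1) ≠ 0) (hnondeg : h.SeparatingLeft)
    {u : V} (hu : IsPrimitiveVector p ℓ u) : ∃ w, h u w = 1 := by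
  have h1 := hu.unif_pow_smul_ne_zero hm hp hp' (i := 2 * ℓ - 2) (by omega)
  have h2 : ∃ w, h (unif p ℓ ^ (2 * ℓ - 2) • u) w ≠ 0 := by
    by_contra! h3
    exact h1 (hnondeg _ h3)
  obtain ⟨w, hw⟩ := h2
  rcases unif_dvd_or_isUnit hm (h u w) with ⟨z, hz⟩ | hu
  · refine absurd ?_ hw
    have h4 : unif p ℓ ^ (2 * ℓ - 2) * unif p ℓ = 0 := by
      rw [← pow_succ, show 2 * ℓ - 2 + 1 = 2 * ℓ - 1 by omega, unif_pow_eq_zero]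
    have h5 : Even (2 * ℓ - 2) := ⟨ℓ - 1, by omega⟩
    have h6 : (-unif p ℓ) ^ (2 * ℓ - 2) = unif p ℓ ^ (2 * ℓ - 2) := h5.neg_pow (unif p ℓ)
    rw [form_smul_left, map_pow, conj_unif, hz, h6]
    linear_combination z * h4
  · obtain ⟨c, hc⟩ := hu.exists_left_inv
    exact ⟨c • w, by rw [form_smul_right, hc]⟩

variable [Module.Free (Ext R p ℓ) V] [Module.Finite (Ext R p ℓ) V]

/-- Primitive vectors of the same length are conjugate under the unitary group. -/
theorem exists_unitary_smul_eq [Finite R] (hm : IsLocalRing.maximalIdeal R = Ideal.span {p})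
    (hℓ : 1 ≤ ℓ) (hp : p ^ ℓ = 0) (hp' : p ^ (ℓ - 1) ≠ 0) (h2 : IsUnit (2 : R))
    (hskew : IsSkewHermitian h) (hnondeg : h.SeparatingLeft) {u v : V}
    (hu : IsPrimitiveVector p ℓ u) (hv : IsPrimitiveVector p ℓ v) (huv : h u u = h v v) :
    ∃ g : unitary h, g • u = v := by
  obtain ⟨w, hw, hw'⟩ : ∃ w, IsUnit (h u w) ∧ IsUnit (h v w) := by
    obtain ⟨w₁, hw₁⟩ := hu.exists_form_eq_one hm hℓ hp hp' hnondeg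
    obtain ⟨w₂, hw₂⟩ := hv.exists_form_eq_one hm hℓ hp hp' hnondeg
    rcases unif_dvd_or_isUnit hm (h v w₁) with h₁ | h₁
    · rcases unif_dvd_or_isUnit hm (h u w₂) with h₂ | h₂
      · refine ⟨w₁ + w₂, ?_, ?_⟩
        · rw [map_add, hw₁]
          exact IsUnit.add_of_unif_dvd isUnit_one h₂
        · rw [map_add, hw₂, add_comm]
          exact IsUnit.add_of_unif_dvd isUnit_one h₁
      · exact ⟨w₂, h₂, hw₂ ▸ isUnit_one⟩
    · exact ⟨w₁, hw₁ ▸ isUnit_one, h₁⟩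
  obtain ⟨c, hc⟩ := hw.exists_left_inv
  have hcu : h u (c • w) = 1 := by rw [form_smul_right, hc]
  have hcv : IsUnit (h v (c • w)) := by
    rw [form_smul_right]
    exact (IsUnit.of_mul_eq_one _ hc).mul hw'
  -- `h v u` need not be a unit, so the isometry passes through a third vector `z` of the same
  -- length. Correcting the length of `c • w` by a multiple of `π` keeps its pairings with `u` and
  -- `v` units.
  have hab : h (c • w) (-u) = 1 := by rw [map_neg, hskew u, hcu, map_one, neg_neg]
  obtain ⟨t, ht, -, hz⟩ := exists_form_add_smul_eq (x := 0) hp h2 hskew hab (hskew.conj_self u)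
    (zero_mul _)
  have hπt := unif_dvd_of_conj_eq_neg hp h2 ht
  set z := c • w + t • (-u)
  have hzu : IsUnit (h z u) := by
    refine isUnit_form_comm hskew ?_
    rw [map_add, hcu, form_smul_right]
    exact IsUnit.add_of_unif_dvd isUnit_one (hπt.mul_right _)
  have hzv : IsUnit (h v z) := by
    rw [map_add, form_smul_right t]
    exact IsUnit.add_of_unif_dvd hcv (hπt.mul_right _)
  obtain ⟨g, hg⟩ := exists_unitary_of_isUnit_form hp h2 hskew hnondeg hz.symm hzu
  obtain ⟨g', hg'⟩ := exists_unitary_of_isUnit_form hp h2 hskew hnondeg (hz.trans huv) hzv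
  exact ⟨g' * g, by rw [mul_smul, hg, hg']⟩

theorem exists_isPrimitiveVector_form_eq [Finite R] [Nontrivial V]
    (hm : IsLocalRing.maximalIdeal R = Ideal.span {p})
    (hℓ : 1 ≤ ℓ) (hp : p ^ ℓ = 0) (hp' : p ^ (ℓ - 1) ≠ 0) (h2 : IsUnit (2 : R))
    (hskew : IsSkewHermitian h) (hnondeg : h.SeparatingLeft) {s : Ext R p ℓ}
    (hs : conj p ℓ s = - s) : ∃ u : V, IsPrimitiveVector p ℓ u ∧ h u u = s := by
  obtain ⟨u, hu⟩ := exists_isPrimitiveVector (p := p) (ℓ := ℓ) (V := V)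
  obtain ⟨w, hw⟩ := hu.exists_form_eq_one hm hℓ hp hp' hnondeg
  obtain ⟨t, ht, -, he⟩ := exists_form_add_smul_eq (x := 0) hp h2 hskew hw hs (zero_mul _)
  exact ⟨_, hu.add_smul (unif_dvd_of_conj_eq_neg hp h2 ht) w, he⟩

/-- Multiplying by `π ^ (2ℓ - 1 - i)` kills the left side, but not the right side if `j < i`. -/
theorem unif_pow_smul_injective (hm : IsLocalRing.maximalIdeal R = Ideal.span {p})
    (hp : p ^ ℓ = 0) (hp' : p ^ (ℓ - 1) ≠ 0) {u v : V} (hv : IsPrimitiveVector p ℓ v)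
    {i j : ℕ} (hi : i ≤ 2 * ℓ - 1) (huv : unif p ℓ ^ i • u = unif p ℓ ^ j • v) : i ≤ j := by
  by_contra! hji
  refine hv.unif_pow_smul_ne_zero hm hp hp' (i := 2 * ℓ - 1 - i + j) (by omega) ?_
  rw [pow_add, mul_smul, ← huv, smul_smul, ← pow_add, Nat.sub_add_cancel hi, unif_pow_eq_zero]
  exact zero_smul (Ext R p ℓ) u

theorem numOrbits_unitary [Finite R] [Nontrivial V]
    (hm : IsLocalRing.maximalIdeal R = Ideal.span {p})
    (hℓ : 1 ≤ ℓ) (hp : p ^ ℓ = 0) (hp' : p ^ (ℓ - 1) ≠ 0) (h2 : IsUnit (2 : R))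
    (hskew : IsSkewHermitian h) (hnondeg : h.SeparatingLeft) :
    numOrbits (unitary h) V = 2 * ∑ i ∈ Finset.range ℓ,
      Nat.card (IsLocalRing.ResidueField R) ^ i := by
  have hform : ∀ (g : unitary h) (u : V), h (g • u) (g • u) = h u u := fun g u => g.2 u u
  have hsmul : ∀ (g : unitary h) (x : Ext R p ℓ) (u : V), g • (x • u) = x • (g • u) :=
    fun g x u => map_smul g.1 x u
  rw [← sum_card_skewMultiples hm hp hp' h2, ← Fin.sum_univ_eq_sum_range
    (fun i => Nat.card (skewMultiples p ℓ i)), ← Nat.card_sigma]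
  have hex : ∀ y : Σ i : Fin (2 * ℓ), skewMultiples p ℓ i, ∃ u : V, IsPrimitiveVector p ℓ u ∧
      unif p ℓ ^ (y.1 : ℕ) * h u u = y.2 := by
    rintro ⟨i, _, s, hs, rfl⟩
    obtain ⟨u, hu, rfl⟩ := exists_isPrimitiveVector_form_eq hm hℓ hp hp' h2 hskew hnondeg hs
    exact ⟨u, hu, rfl⟩
  choose F hF hF' using hex
  refine (Nat.card_congr (Equiv.ofBijective (fun y => (Quotient.mk _ (unif p ℓ ^ (y.1 : ℕ) • F y) :
    MulAction.orbitRel.Quotient (unitary h) V)) ⟨?_, ?_⟩)).symm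
  · intro y z hyz
    obtain ⟨g, hg⟩ := Quotient.exact hyz
    simp only [hsmul] at hg
    have h1 : y.1 = z.1 := Fin.ext (le_antisymm
      (unif_pow_smul_injective hm hp hp' (smul_isPrimitiveVector g (hF z)) (by omega) hg.symm)
      (unif_pow_smul_injective hm hp hp' (hF y) (by omega) hg))
    obtain ⟨i, y⟩ := y
    obtain ⟨j, z⟩ := z
    obtain rfl : i = j := h1
    have h3 := unif_pow_mul_form_eq (h := h) hg
    rw [hform, hF' ⟨i, y⟩, hF' ⟨i, z⟩] at h3
    obtain rfl : z = y := Subtype.ext h3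
    rfl
  · intro z
    induction z using Quotient.inductionOn with
    | h v =>
      obtain ⟨k, hk, u, hu, rfl⟩ := exists_isPrimitiveVector_eq_pow_smul (p := p) (ℓ := ℓ) v
      let y : Σ i : Fin (2 * ℓ), skewMultiples p ℓ i :=
        ⟨⟨k, by omega⟩, _, h u u, hskew.conj_self u, rfl⟩
      refine ⟨y, Quotient.sound ?_⟩
      have hy : unif p ℓ ^ k * h (F y) (F y) = unif p ℓ ^ k * h u u := hF' y
      obtain ⟨w, hw⟩ := hu.exists_form_eq_one hm hℓ hp hp' hnondeg
      -- The lengths of `u` and `F y` agree only up to the annihilator of `π ^ k`. A correction `t`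
      -- in that annihilator makes them equal and leaves `π ^ k • u` unchanged.
      obtain ⟨t, ht, hkt, he⟩ := exists_form_add_smul_eq (x := unif p ℓ ^ k) hp h2 hskew hw
        (hskew.conj_self (F y)) (by rw [mul_sub, hy, sub_self])
      have hprim := hu.add_smul (unif_dvd_of_conj_eq_neg hp h2 ht) w
      obtain ⟨g, hg⟩ := exists_unitary_smul_eq hm hℓ hp hp' h2 hskew hnondeg hprim (hF y) he
      refine ⟨g, ?_⟩
      change g • unif p ℓ ^ k • u = unif p ℓ ^ k • F y
      have e : unif p ℓ ^ k • u = unif p ℓ ^ k • (u + t • w) := by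
        rw [smul_add, smul_smul, hkt]
        exact (add_eq_left.2 (zero_smul (Ext R p ℓ) w)).symm
      rw [e, hsmul, hg]

/-- The form `f` separates points, even after composition with a primitive character. -/
theorem exists_addChar_assocForm_ne_one [Nontrivial V]
    (hm : IsLocalRing.maximalIdeal R = Ideal.span {p})
    (hℓ : 1 ≤ ℓ) (hp : p ^ ℓ = 0) (hp' : p ^ (ℓ - 1) ≠ 0) (h2 : IsUnit (2 : R))
    (hskew : IsSkewHermitian h) (hnondeg : h.SeparatingLeft) {lam : AddChar R ℂ}
    (hlam : lam.IsPrimitive) {v : V} (hv : v ≠ 0) :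
    ∃ w, lam (2 * assocForm hp h w v) ≠ 1 := by
  obtain ⟨k, hk, u, hu, rfl⟩ := exists_isPrimitiveVector_eq_pow_smul (p := p) (ℓ := ℓ) v
  have hk' : k ≤ 2 * ℓ - 2 := by
    by_contra! hlt
    obtain rfl : k = 2 * ℓ - 1 := by omega
    rw [unif_pow_eq_zero] at hv
    exact hv (zero_smul (Ext R p ℓ) u)
  obtain ⟨w, hw⟩ := hu.exists_form_eq_one hm hℓ hp hp' hnondeg
  have hwu : h (-w) u = 1 := by rw [map_neg, LinearMap.neg_apply, hskew u w, hw, map_one, neg_neg]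
  have hne : 2 * p ^ (ℓ - 1) ≠ 0 := fun h0 => hp' (h2.mul_right_eq_zero.1 h0)
  obtain ⟨r, hr⟩ := AddChar.ne_one_iff.1 (hlam hne)
  -- The scalar completes `π ^ k` to `π ^ (2ℓ - 2) = p ^ (ℓ - 1)`, so the form takes the value `r *
  -- p ^ (ℓ - 1)` in `R`; `conj` offsets the semilinearity in the first variable.
  refine ⟨conj p ℓ (algebraMap R _ r * unif p ℓ ^ (2 * ℓ - 2 - k)) • -w, ?_⟩
  have e : algebraMap R (Ext R p ℓ) r * unif p ℓ ^ (2 * ℓ - 2 - k) * (unif p ℓ ^ k * 1) =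
      algebraMap R (Ext R p ℓ) (r * p ^ (ℓ - 1)) := by
    rw [mul_one, mul_assoc, ← pow_add, Nat.sub_add_cancel hk',
      show 2 * ℓ - 2 = 2 * (ℓ - 1) by omega, unif_pow_even, map_mul]
  rw [assocForm_apply, form_smul_left, conj_conj, form_smul_right, hwu, e, realPart_algebraMap,
    mul_comm r, ← mul_assoc]
  exact hr

end Hermitian

end RamifiedUnitary

theorem mainTheorem8 (R : Type*) [CommRing R] [Finite R] [IsLocalRing R]
    [IsPrincipalIdealRing R]
    (hchar : ringChar (IsLocalRing.ResidueField R) ≠ 2)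
    (q : ℕ) (hq : Nat.card (IsLocalRing.ResidueField R) = q)
    (p : R) (hm : IsLocalRing.maximalIdeal R = Ideal.span {p})
    (ℓ : ℕ) (hℓ : 1 ≤ ℓ) (hp : p ^ ℓ = 0) (hp' : p ^ (ℓ - 1) ≠ 0)
    (V : Type*) [AddCommGroup V] [Module (RamifiedUnitary.Ext R p ℓ) V]
    [Module.Free (RamifiedUnitary.Ext R p ℓ) V] [Module.Finite (RamifiedUnitary.Ext R p ℓ) V]
    [Nontrivial V]
    (h : V →ₛₗ[RamifiedUnitary.conj p ℓ] V →ₗ[RamifiedUnitary.Ext R p ℓ]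
      RamifiedUnitary.Ext R p ℓ)
    (hskew : RamifiedUnitary.IsSkewHermitian h) (hnondeg : h.SeparatingLeft) :
    RamifiedUnitary.numOrbits (RamifiedUnitary.unitary h) V = 2 * ∑ i ∈ Finset.range ℓ, q ^ i ∧
    ∀ (lam : AddChar R ℂ), lam.IsPrimitive →
      ∀ (M : Type*) [AddCommGroup M] [Module ℂ M] [FiniteDimensional ℂ M]
        (S : Representation ℂ
          (RamifiedUnitary.Heisenberg (RamifiedUnitary.assocForm hp h)) M)
        (W : Representation ℂ (RamifiedUnitary.unitary h) M),
        RamifiedUnitary.IsSchrodinger (RamifiedUnitary.assocForm hp h) lam S →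
        RamifiedUnitary.IsWeil hp h S W →
        Module.finrank ℂ (W.IntertwiningMap W) =
          RamifiedUnitary.numOrbits (RamifiedUnitary.unitary h) V := by
  have h2 := RamifiedUnitary.isUnit_two hchar
  refine ⟨hq ▸ RamifiedUnitary.numOrbits_unitary hm hℓ hp hp' h2 hskew hnondeg, ?_⟩
  intro lam hlam M _ _ _ S W hS hW
  have : Finite V := Module.finite_of_finite (RamifiedUnitary.Ext R p ℓ)
  obtain ⟨b, hb⟩ := RamifiedUnitary.exists_basis_of_isSchrodinger hS
    (RamifiedUnitary.assocForm_swap hp hskew) fun v hv =>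
    RamifiedUnitary.exists_addChar_assocForm_ne_one hm hℓ hp hp' h2 hskew hnondeg hlam hv
  refine RamifiedUnitary.finrank_intertwiningMap_of_basis W b fun g v => ?_
  rw [hb, hb]
  exact hW g 0 v
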